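/- Let $(\Omega,\mathcal F,(\mathcal F_t)_{t\ge0},(Y_t)_{t\ge 0},(\mathbb P^x)_{x\in\mathbb R^d})$ be a (time-homogeneous) Markov process with values in $\mathbb R^d$: $(Y_t)$ is adapted to the filtration $(\mathcal F_t)$, each $\mathbb P^x$ is a probability measure with $\mathbb P^x(Y_0=x)=1$, the map $x\mapsto\mathbb P^x(Y_t\in B)$ is Borel measurable, and $\mathbb P^x(Y_{s+t}\in B\mid\mathcal F_s)=\mathbb P^{Y_s}(Y_t\in B)$ holds $\mathbb P^x$-a.s. for all $s,t\ge0$, $x\in\mathbb R^d$ and Borel sets $B\subset\mathbb R^d$. Assume that $(t,\omega)\mapsto Y_t(\omega)$ is jointly measurable (for instance, that all paths are right-continuous). For $x\in\mathbb R^d$ define $$\beta'(Y,x):=\sup\Big\{\lambda\ge 0:\ \mathbb E^x\big(|Y_t-Y_s|^{-\lambda}\big)=O\big(|t-s|^{-1}\big)\ \text{ as } t-s\to0\Big\}\in[0,\infty],$$ where the condition on $\lambda$ means that there are constants $C<\infty$ and $\delta>0$ such that $\mathbb E^x(|Y_t-Y_s|^{-\lambda})\le C|t-s|^{-1}$ for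 all $s,t\ge0$ with $0<|t-s|<\delta$, with the conventions $0^{-\lambda}=\infty$ for $\lambda>0$ and $0^0=1$. Then, for every $x\in\mathbb R^d$ and every analytic set $E\subset[0,1]$, $$\dim_H Y(E)\ \ge\ \beta'(Y,x)\,\dim_H E\qquad \mathbb P^x\text{-a.s.},$$ where $\dim_H$ denotes the Hausdorff dimension, $Y(E)=Y(E,\omega)=\{Y_t(\omega):t\in E\}$, and $0\cdot\infty=0$. -/

import Mathlib

open MeasureTheory Set
open scoped NNReal ENNReal

/-- A (time-homogeneous, conservative) Markov process `(Ω, 𝓕, (𝓕_t), (Y_t), (P^x))` with time set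
`[0, ∞)` and values in `ℝ^d`: a family of probability measures `P^x`, one for every starting point
`x`, under each of which the adapted process `Y` starts at `x` and satisfies
`P^x(Y_{s+t} ∈ B | 𝓕_s) = P^{Y_s}(Y_t ∈ B)` almost surely. -/
structure MarkovProcess (d : ℕ) (Ω : Type*) [mΩ : MeasurableSpace Ω] where
  /-- the filtration `(𝓕_t)` -/
  filt : Filtration ℝ≥0 mΩ
  /-- the random variables `Y_t` -/
  Y : ℝ≥0 → Ω → EuclideanSpace ℝ (Fin d)
  /-- the laws `P^x` -/
  P : EuclideanSpace ℝ (Fin d) → Measure Ω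
  isProbabilityMeasure (x : EuclideanSpace ℝ (Fin d)) : IsProbabilityMeasure (P x)
  adapted (t : ℝ≥0) : Measurable[filt t] (Y t)
  measurable_transition (t : ℝ≥0) (B : Set (EuclideanSpace ℝ (Fin d))) (hB : MeasurableSet B) :
    Measurable fun x => P x {ω | Y t ω ∈ B}
  start (x : EuclideanSpace ℝ (Fin d)) : ∀ᵐ ω ∂(P x), Y 0 ω = x
  markov (x : EuclideanSpace ℝ (Fin d)) (s t : ℝ≥0) (B : Set (EuclideanSpace ℝ (Fin d)))
    (hB : MeasurableSet B) :
    condExp (filt s) (P x) ({ω | Y (s + t) ω ∈ B}.indicator fun _ => (1 : ℝ))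
      =ᵐ[P x] fun ω => (P (Y s ω)).real {ω' | Y t ω' ∈ B}

namespace MarkovProcess

variable {d : ℕ} {Ω : Type*} [MeasurableSpace Ω]

/-- `E^x |Y_t - Y_s|^{-l} = O(|t - s|⁻¹)` as `t - s → 0`, where `s, t` range over `[0, ∞)`, `s ≠ t`.
The expectation is a Lebesgue integral with values in `[0, ∞]`, where `0^{-l} = ∞` for `l > 0` and
`0^0 = 1`. -/
def NegMomentBound (M : MarkovProcess d Ω) (x : EuclideanSpace ℝ (Fin d)) (l : ℝ≥0) : Prop :=
  ∃ C : ℝ≥0, ∃ δ : ℝ, 0 < δ ∧ ∀ s t : ℝ≥0, s ≠ t → dist t s < δ →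
    ∫⁻ ω, ‖M.Y t ω - M.Y s ω‖ₑ ^ (-(l : ℝ)) ∂(M.P x) ≤ C * (edist t s)⁻¹

/-- The index `β'(Y, x)`, the supremum (in `[0, ∞]`) of all `l ≥ 0` with
`E^x |Y_t - Y_s|^{-l} = O(|t - s|⁻¹)` as `t - s → 0`. -/
noncomputable def betaPrime (M : MarkovProcess d Ω) (x : EuclideanSpace ℝ (Fin d)) : ℝ≥0∞ :=
  sSup {b : ℝ≥0∞ | ∃ l : ℝ≥0, M.NegMomentBound x l ∧ b = l}

end MarkovProcess

/-! This is the energy method. Fix `b < dimH E` and `l` satisfying the negative moment bound.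
Frostman's lemma gives a finite measure `μ` charging `E` whose `b`-potentials are uniformly bounded.
As `E` lies in the half-line, `b ≤ 1`, so Jensen turns the bound of order `|t - s|⁻¹` for the
`-l`-th moment into one of order `|t - s| ^ (-b)` for the `-(l * b)`-th. By Tonelli the expected `l
* b`-energy of the image of (a localised) `μ` under `Y` is finite; hence the energy is almost surely
finite and `dimH Y(E) ≥ l * b`. Countably many `l` and `b` suffice to reach the two suprema.

The potential theory is `exists_lintegral_edist_rpow_le` and `le_dimH_image_of_lintegral_edist`.
Frostman's lemma for analytic sets (`exists_frostman`) goes through the dyadic Hausdorff content.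
The content is subadditive and continuous along increasing sequences (`exists_lt_dyadicContent`), so
positive content passes from an analytic set to a compact subset `K`. There the content of `K ∩ [0,
t)`, as a function of `t`, is the distribution function of the required measure. -/

/-! ### Dyadic intervals and dyadic content. -/

/-- The half-open dyadic interval `[k / 2 ^ n, (k + 1) / 2 ^ n)`, indexed by `(n, k)`. -/
def dyadic (p : ℕ × ℕ) : Set ℝ≥0 := {t | ⌊2 ^ p.1 * t⌋₊ = p.2}

lemma mem_dyadic_floor (n : ℕ) (t : ℝ≥0) : t ∈ dyadic (n, ⌊2 ^ n * t⌋₊) := rfl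

lemma dyadic_nonempty (p : ℕ × ℕ) : (dyadic p).Nonempty := by
  refine ⟨p.2 / 2 ^ p.1, ?_⟩
  simp [dyadic, mul_div_cancel₀]

lemma mem_dyadic_iff {p : ℕ × ℕ} {t : ℝ≥0} :
    t ∈ dyadic p ↔ (p.2 : ℝ≥0) ≤ 2 ^ p.1 * t ∧ 2 ^ p.1 * t < p.2 + 1 := by
  rw [dyadic, mem_ofPred_eq, Nat.floor_eq_iff zero_le]

lemma dyadic_subset_of_le {p q : ℕ × ℕ} (h : (dyadic q ∩ dyadic p).Nonempty) (hpq : p.1 ≤ q.1) :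
    dyadic q ⊆ dyadic p := by
  obtain ⟨t, htq, htp⟩ := h
  have key (u : ℝ≥0) : ⌊2 ^ p.1 * u⌋₊ = ⌊2 ^ q.1 * u⌋₊ / 2 ^ (q.1 - p.1) := by
    rw [← Nat.floor_div_natCast]
    congr 1
    obtain ⟨m, hm⟩ := Nat.exists_eq_add_of_le hpq
    rw [hm, Nat.add_sub_cancel_left, pow_add]
    push_cast
    field_simp
  intro u hu
  simp only [dyadic, mem_ofPred_eq] at *
  rw [← htp, key u, key t, hu, htq]

lemma dyadic_eq_of_inter {p q : ℕ × ℕ} (h : (dyadic q ∩ dyadic p).Nonempty) (hpq : p.1 = q.1) :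
    p = q := by
  obtain ⟨t, htq, htp⟩ := h
  refine Prod.ext hpq ?_
  simp only [dyadic, mem_ofPred_eq] at *
  rw [← htp, ← htq, hpq]

/-- The measure on the index set of dyadic intervals giving mass `r ^ n` to each interval of
level `n`. -/
noncomputable def dyadicWeight (r : ℝ≥0∞) : Measure (ℕ × ℕ) :=
  Measure.count.withDensity fun p => r ^ p.1

lemma dyadicWeight_singleton (r : ℝ≥0∞) (p : ℕ × ℕ) : dyadicWeight r {p} = r ^ p.1 := by
  rw [dyadicWeight, withDensity_apply _ (measurableSet_singleton p)]
  simp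

lemma dyadicWeight_apply (r : ℝ≥0∞) (C : Set (ℕ × ℕ)) :
    dyadicWeight r C = ∑' p : C, r ^ p.1.1 := by
  have := (measure_biUnion (μ := dyadicWeight r) (C.to_countable) (f := fun p => {p})
    (fun p _ q _ hpq => by simpa using hpq) (fun p _ => measurableSet_singleton p))
  simpa [dyadicWeight_singleton] using this

/-- The Hausdorff content of a set of nonnegative reals for coverings by dyadic intervals, where
intervals of level `n` have weight `r ^ n`. -/
noncomputable def dyadicContent (r : ℝ≥0∞) (A : Set ℝ≥0) : ℝ≥0∞ :=
  ⨅ (C : Set (ℕ × ℕ)) (_ : A ⊆ ⋃ p ∈ C, dyadic p), dyadicWeight r C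

lemma dyadicContent_le {r : ℝ≥0∞} {A : Set ℝ≥0} {C : Set (ℕ × ℕ)}
    (h : A ⊆ ⋃ p ∈ C, dyadic p) : dyadicContent r A ≤ dyadicWeight r C :=
  iInf₂_le C h

lemma exists_dyadicWeight_lt {r : ℝ≥0∞} {A : Set ℝ≥0} {c : ℝ≥0∞} (h : dyadicContent r A < c) :
    ∃ C : Set (ℕ × ℕ), A ⊆ ⋃ p ∈ C, dyadic p ∧ dyadicWeight r C < c := by
  simpa [dyadicContent, iInf_lt_iff] using h

lemma dyadicContent_mono (r : ℝ≥0∞) {A B : Set ℝ≥0} (h : A ⊆ B) :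
    dyadicContent r A ≤ dyadicContent r B :=
  le_iInf₂ fun _ hC => dyadicContent_le (h.trans hC)

lemma dyadicContent_empty (r : ℝ≥0∞) : dyadicContent r ∅ = 0 :=
  le_antisymm ((dyadicContent_le (C := ∅) (by simp)).trans (by simp)) zero_le

lemma dyadicContent_union_le (r : ℝ≥0∞) (A B : Set ℝ≥0) :
    dyadicContent r (A ∪ B) ≤ dyadicContent r A + dyadicContent r B := by
  refine ENNReal.le_of_forall_pos_le_add fun ε hε hfin => ?_
  have hε2 : (ε / 2 : ℝ≥0∞) ≠ 0 := by simp [hε.ne']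
  rw [ENNReal.add_lt_top] at hfin
  obtain ⟨C, hC, hCl⟩ := exists_dyadicWeight_lt (ENNReal.lt_add_right hfin.1.ne hε2)
  obtain ⟨D, hD, hDl⟩ := exists_dyadicWeight_lt (ENNReal.lt_add_right hfin.2.ne hε2)
  calc dyadicContent r (A ∪ B) ≤ dyadicWeight r (C ∪ D) := by
        refine dyadicContent_le ?_
        rw [biUnion_union]
        exact union_subset_union hC hD
    _ ≤ dyadicWeight r C + dyadicWeight r D := measure_union_le _ _
    _ ≤ (dyadicContent r A + ε / 2) + (dyadicContent r B + ε / 2) := add_le_add hCl.le hDl.le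
    _ = _ := by rw [add_add_add_comm, ENNReal.add_halves]

/-- The dyadic content is continuous along increasing sequences of arbitrary sets. -/
lemma exists_lt_dyadicContent {r : ℝ≥0∞} {A : ℕ → Set ℝ≥0} (hA : Monotone A) {c : ℝ≥0∞}
    (h : c < dyadicContent r (⋃ n, A n)) : ∃ n, c < dyadicContent r (A n) := by
  by_contra! hle
  refine h.not_ge (ENNReal.le_of_forall_pos_le_add fun ε hε hc => ?_)
  have hε2 : (ε / 2 : ℝ≥0∞) ≠ 0 := by simp [hε.ne']
  obtain ⟨e, he, hsum⟩ := ENNReal.exists_pos_sum_of_countable' hε2 ℕ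
  have hcov (n : ℕ) : ∃ C : Set (ℕ × ℕ), A n ⊆ ⋃ p ∈ C, dyadic p ∧
      dyadicWeight r C < dyadicContent r (A n) + e n :=
    exists_dyadicWeight_lt (ENNReal.lt_add_right ((hle n).trans_lt hc).ne (he n).ne')
  choose C hC hCl using hcov
  have hCfin (n : ℕ) : dyadicWeight r (C n) ≠ ∞ := (hCl n).ne_top
  set T : Set (ℕ × ℕ) := ⋃ n, C n with hT
  -- `Mx` consists of the maximal intervals among all the covers; they are pairwise disjoint and
  -- still cover.
  set Mx : Set (ℕ × ℕ) := {p ∈ T | ∀ q ∈ T, (dyadic q ∩ dyadic p).Nonempty → p.1 ≤ q.1} with hMx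
  have hcover : (⋃ n, A n) ⊆ ⋃ p ∈ Mx, dyadic p := by
    intro t ht
    obtain ⟨n, hn⟩ := mem_iUnion.1 ht
    have hex : ∃ l, ∃ p ∈ T, t ∈ dyadic p ∧ p.1 = l := by
      obtain ⟨p, hp, htp⟩ := mem_iUnion₂.1 (hC n hn)
      exact ⟨_, p, mem_iUnion.2 ⟨n, hp⟩, htp, rfl⟩
    classical
    obtain ⟨p, hpT, htp, hpl⟩ := Nat.find_spec hex
    refine mem_iUnion₂.2 ⟨p, ⟨hpT, fun q hq hqp => ?_⟩, htp⟩
    by_contra! hlt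
    have hsub := dyadic_subset_of_le (p := q) (q := p) (by rwa [inter_comm]) hlt.le
    exact Nat.find_min hex (hpl ▸ hlt) ⟨q, hq, hsub htp, rfl⟩
  have hMxeq {p q : ℕ × ℕ} (hp : p ∈ Mx) (hq : q ∈ Mx) (hpq : (dyadic q ∩ dyadic p).Nonempty) :
      p = q :=
    dyadic_eq_of_inter hpq
      (le_antisymm (hp.2 q hq.1 hpq) (hq.2 p hp.1 (by rwa [inter_comm])))
  -- Each maximal interval is attributed to the first cover `C k` containing it.
  set F : ℕ → Set (ℕ × ℕ) := fun k => Mx ∩ disjointed C k with hF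
  have hFMx : Mx = ⋃ k, F k := by
    rw [hF, ← inter_iUnion, iUnion_disjointed, inter_eq_left.2]
    exact fun p hp => hp.1
  have hFC (k : ℕ) : F k ⊆ C k := fun p hp => disjointed_subset C k hp.2
  refine (dyadicContent_le hcover).trans ?_
  rw [hFMx]
  refine (measure_iUnion_le F).trans (ENNReal.tsum_le_of_sum_range_le fun m => ?_)
  set D : ℕ → Set (ℕ × ℕ) := fun k => {q ∈ C m | ∃ p ∈ F k, dyadic q ⊆ dyadic p} with hD
  -- Exchanging `F k` for `D k` in `C k` leaves a cover of `A k`, because `A k ⊆ A m` and `F k` is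
  -- maximal. As `C k` is optimal up to `e k`, the exchange saves at most `e k`.
  have hFD (k : ℕ) (hk : k < m) : dyadicWeight r (F k) ≤ dyadicWeight r (D k) + e k := by
    have hcovk : A k ⊆ ⋃ p ∈ (C k \ F k) ∪ D k, dyadic p := by
      intro t ht
      obtain ⟨p, hp, htp⟩ := mem_iUnion₂.1 (hC k ht)
      by_cases hpF : p ∈ F k
      · obtain ⟨q, hq, htq⟩ := mem_iUnion₂.1 (hC m (hA hk.le ht))
        have hne : (dyadic q ∩ dyadic p).Nonempty := ⟨t, htq, htp⟩
        exact mem_iUnion₂.2 ⟨q, Or.inr ⟨hq, p, hpF, dyadic_subset_of_le hne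
          (hpF.1.2 q (mem_iUnion.2 ⟨m, hq⟩) hne)⟩, htq⟩
      · exact mem_iUnion₂.2 ⟨p, Or.inl ⟨hp, hpF⟩, htp⟩
    have h1 : dyadicWeight r (F k) + dyadicWeight r (C k \ F k) = dyadicWeight r (C k) := by
      rw [← measure_sdiff_add_inter (μ := dyadicWeight r) (C k) (t := F k)
        (DiscreteMeasurableSpace.forall_measurableSet _), inter_eq_right.2 (hFC k), add_comm]
    have h2 : dyadicWeight r (C k \ F k) ≠ ∞ :=
      ne_top_of_le_ne_top (hCfin k) (measure_mono sdiff_subset)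
    refine (ENNReal.add_le_add_iff_right h2).1 ?_
    calc dyadicWeight r (F k) + dyadicWeight r (C k \ F k)
        ≤ dyadicContent r (A k) + e k := h1 ▸ (hCl k).le
      _ ≤ (dyadicWeight r (C k \ F k) + dyadicWeight r (D k)) + e k := by
          gcongr
          exact (dyadicContent_le hcovk).trans (measure_union_le _ _)
      _ = _ := by ring
  -- Disjointness makes the weights of the `D k` add up to at most the single weight of `C m`, which
  -- is at most `c + e m`.
  have hDdisj : Pairwise (Function.onFun Disjoint D) := by
    intro k l hkl
    refine Set.disjoint_left.2 fun q ⟨_, p, hp, hqp⟩ ⟨_, p', hp', hqp'⟩ => ?_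
    obtain ⟨t, ht⟩ := dyadic_nonempty q
    obtain rfl := hMxeq hp.1 hp'.1 ⟨t, hqp' ht, hqp ht⟩
    exact Set.disjoint_left.1 (disjoint_disjointed C hkl) hp.2 hp'.2
  calc ∑ k ∈ Finset.range m, dyadicWeight r (F k)
      ≤ ∑ k ∈ Finset.range m, (dyadicWeight r (D k) + e k) :=
        Finset.sum_le_sum fun k hk => hFD k (Finset.mem_range.1 hk)
    _ = dyadicWeight r (⋃ k ∈ Finset.range m, D k) + ∑ k ∈ Finset.range m, e k := by
        rw [Finset.sum_add_distrib, measure_biUnion_finset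
          (fun k _ l _ hkl => hDdisj hkl) (fun _ _ => DiscreteMeasurableSpace.forall_measurableSet _)]
    _ ≤ dyadicWeight r (C m) + ∑ k ∈ Finset.range m, e k := by
        gcongr
        exact iUnion₂_subset fun k _ q hq => hq.1
    _ ≤ (c + e m) + ∑ k ∈ Finset.range m, e k := by
        gcongr
        exact (hCl m).le.trans (add_le_add (hle m) le_rfl)
    _ = c + ∑ k ∈ Finset.range (m + 1), e k := by rw [Finset.sum_range_succ]; ring
    _ ≤ c + ε := by
        gcongr
        exact (ENNReal.sum_le_tsum _).trans (hsum.le.trans ENNReal.half_le_self)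

/-! ### Dyadic content and Hausdorff measure. -/

lemma ediam_dyadic_le (p : ℕ × ℕ) : Metric.ediam (dyadic p) ≤ (2 : ℝ≥0∞)⁻¹ ^ p.1 := by
  refine Metric.ediam_le fun s hs t ht => ?_
  have h2 : (0 : ℝ) < 2 ^ p.1 := by positivity
  obtain ⟨hs1, hs2⟩ := mem_dyadic_iff.1 hs
  obtain ⟨ht1, ht2⟩ := mem_dyadic_iff.1 ht
  rw [← NNReal.coe_le_coe] at hs1 ht1
  rw [← NNReal.coe_lt_coe] at hs2 ht2
  push_cast at hs1 hs2 ht1 ht2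
  have hd : nndist s t ≤ (2 : ℝ≥0)⁻¹ ^ p.1 := by
    rw [← NNReal.coe_le_coe, coe_nndist, NNReal.dist_eq]
    push_cast
    rw [inv_pow, ← one_div, le_div_iff₀ h2, ← abs_of_pos h2, ← abs_mul, abs_le]
    constructor <;> nlinarith
  rw [edist_nndist]
  refine (ENNReal.coe_le_coe.2 hd).trans_eq ?_
  rw [ENNReal.coe_pow, ENNReal.coe_inv two_ne_zero, ENNReal.coe_ofNat]

/-- A set of nonnegative reals of zero dyadic content with weights `(2 ^ (-a)) ^ n` is null for the
`a`-dimensional Hausdorff measure. -/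
lemma hausdorffMeasure_eq_zero_of_dyadicContent {a : ℝ} (ha : 0 < a) {A : Set ℝ≥0}
    (h : dyadicContent ((2 : ℝ≥0∞) ^ (-a)) A = 0) : Measure.hausdorffMeasure a A = 0 := by
  set r : ℝ≥0∞ := (2 : ℝ≥0∞) ^ (-a) with hr
  have hr1 : r < 1 := by
    rw [hr, ENNReal.rpow_neg, ENNReal.inv_lt_one]
    exact ENNReal.one_lt_rpow (by norm_num) ha
  have hr0 : r ≠ 0 := by
    rw [hr]
    simp [ENNReal.rpow_eq_zero_iff]
  have hcov (n : ℕ) : ∃ C : Set (ℕ × ℕ), A ⊆ ⋃ p ∈ C, dyadic p ∧ dyadicWeight r C < r ^ n :=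
    exists_dyadicWeight_lt (h ▸ ENNReal.pow_pos (pos_iff_ne_zero.2 hr0) n)
  choose C hC hCl using hcov
  -- Total weight below `r ^ n` excludes intervals of level below `n`, so small weight alone makes
  -- the covers fine.
  have hlevel (n : ℕ) (p : C n) : n ≤ p.1.1 := by
    by_contra! hlt
    refine (hCl n).not_ge ?_
    calc r ^ n ≤ r ^ p.1.1 := pow_le_pow_right_of_le_one' hr1.le hlt.le
      _ = dyadicWeight r {p.1} := (dyadicWeight_singleton r _).symm
      _ ≤ dyadicWeight r (C n) := measure_mono (singleton_subset_iff.2 p.2)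
  have hhalf : (2 : ℝ≥0∞)⁻¹ < 1 := by simp
  have hle := Measure.hausdorffMeasure_le_liminf_tsum a A (l := Filter.atTop)
    (fun n : ℕ => (2 : ℝ≥0∞)⁻¹ ^ n) (ENNReal.tendsto_pow_atTop_nhds_zero_of_lt_one hhalf)
    (fun n (p : C n) => dyadic p.1)
    (Filter.Eventually.of_forall fun n p => (ediam_dyadic_le _).trans
      (pow_le_pow_right_of_le_one' hhalf.le (hlevel n p)))
    (Filter.Eventually.of_forall fun n => by simpa [iUnion_subtype] using hC n)
  have hsum (n : ℕ) : ∑' p : C n, Metric.ediam (dyadic p.1) ^ a ≤ r ^ n := by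
    refine le_trans ?_ (hCl n).le
    rw [dyadicWeight_apply]
    refine ENNReal.tsum_le_tsum fun p => ?_
    calc Metric.ediam (dyadic p.1) ^ a ≤ ((2 : ℝ≥0∞)⁻¹ ^ p.1.1) ^ a :=
          ENNReal.rpow_le_rpow (ediam_dyadic_le _) ha.le
      _ = r ^ p.1.1 := by
          rw [hr, ← ENNReal.rpow_natCast, ← ENNReal.rpow_natCast, ← ENNReal.rpow_mul,
            ← ENNReal.rpow_mul, ← ENNReal.rpow_neg_one, ← ENNReal.rpow_mul]
          ring_nf
  have htend : Filter.Tendsto (fun n : ℕ => ∑' p : C n, Metric.ediam (dyadic p.1) ^ a)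
      Filter.atTop (nhds 0) :=
    tendsto_of_tendsto_of_tendsto_of_le_of_le tendsto_const_nhds
      (ENNReal.tendsto_pow_atTop_nhds_zero_of_lt_one hr1) (fun _ => zero_le) hsum
  rw [htend.liminf_eq] at hle
  exact le_antisymm hle zero_le

/-! ### Compact subsets of analytic sets. -/

open Filter Topology

lemma dyadicContent_dyadic_le (r : ℝ≥0∞) (p : ℕ × ℕ) : dyadicContent r (dyadic p) ≤ r ^ p.1 :=
  (dyadicContent_le (C := {p}) (by simp)).trans_eq (dyadicWeight_singleton r p)

/-- A neighbourhood of the dyadic interval `p` contained in the union of `p` and its left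
neighbour. -/
lemma exists_isOpen_dyadic (p : ℕ × ℕ) : ∃ U : Set ℝ≥0, IsOpen U ∧ dyadic p ⊆ U ∧
    U ⊆ dyadic p ∪ dyadic (p.1, p.2 - 1) := by
  refine ⟨{t | (p.2 : ℝ≥0) < 2 ^ p.1 * t + 1 ∧ 2 ^ p.1 * t < p.2 + 1}, ?_, ?_, ?_⟩
  · exact (isOpen_lt (by fun_prop) (by fun_prop)).inter (isOpen_lt (by fun_prop) (by fun_prop))
  · intro t ht
    obtain ⟨h1, h2⟩ := mem_dyadic_iff.1 ht
    exact ⟨h1.trans_lt (lt_add_one _), h2⟩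
  · rintro t ⟨h1, h2⟩
    by_cases h : (p.2 : ℝ≥0) ≤ 2 ^ p.1 * t
    · exact Or.inl (mem_dyadic_iff.2 ⟨h, h2⟩)
    · right
      push Not at h
      have hp : 1 ≤ p.2 := by
        by_contra! h0
        simp [Nat.lt_one_iff.1 h0] at h
      obtain ⟨k, hk⟩ := Nat.exists_eq_add_of_le' hp
      refine mem_dyadic_iff.2 ?_
      simp only [hk, Nat.add_sub_cancel]
      rw [hk] at h1 h
      push_cast at h1 h
      exact ⟨(lt_of_add_lt_add_right h1).le, h⟩

lemma dyadicWeight_leftNeighbour_le (r : ℝ≥0∞) (C : Set (ℕ × ℕ)) :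
    dyadicWeight r ((fun p : ℕ × ℕ => (p.1, p.2 - 1)) '' C) ≤ dyadicWeight r C := by
  rw [dyadicWeight_apply r C, ← biUnion_of_singleton C, image_iUnion₂, biUnion_eq_iUnion,
    biUnion_of_singleton]
  refine (measure_iUnion_le _).trans_eq (tsum_congr fun p => ?_)
  rw [image_singleton, dyadicWeight_singleton]

/-- An analytic set of positive dyadic content contains a compact set of positive dyadic content. -/
lemma exists_isCompact_dyadicContent_pos {r : ℝ≥0∞} {E : Set ℝ≥0} (hE : AnalyticSet E)
    (h : dyadicContent r E ≠ 0) : ∃ K ⊆ E, IsCompact K ∧ dyadicContent r K ≠ 0 := by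
  rw [AnalyticSet] at hE
  rcases hE with rfl | ⟨f, hf, rfl⟩
  · exact (h (dyadicContent_empty r)).elim
  obtain ⟨c, hc0, hc⟩ := exists_between (pos_iff_ne_zero.2 h)
  -- Choquet's argument: continuity from below lets the coordinates be bounded one at a time while
  -- the content of the image stays above `c`.
  have hstep (n : ℕ) (S : Set (ℕ → ℕ)) : c < dyadicContent r (f '' S) →
      ∃ m : ℕ, c < dyadicContent r (f '' (S ∩ {x | x n ≤ m})) := by
    intro hS
    refine exists_lt_dyadicContent (A := fun m => f '' (S ∩ {x | x n ≤ m})) ?_ ?_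
    · exact fun m m' hm => image_mono (inter_subset_inter_right _ fun x (hx : x n ≤ m) => hx.trans hm)
    · rwa [← image_iUnion, ← inter_iUnion, iUnion_eq_univ_iff.2 fun x => ⟨x n, le_refl (x n)⟩,
        inter_univ]
  choose! m hm using hstep
  let S : ℕ → Set (ℕ → ℕ) := fun n => Nat.rec univ (fun n T => T ∩ {x | x n ≤ m n T}) n
  have hSsucc (n : ℕ) : S (n + 1) = S n ∩ {x | x n ≤ m n (S n)} := rfl
  have hS (n : ℕ) : c < dyadicContent r (f '' S n) := by
    induction n with
    | zero => simpa [S] using hc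
    | succ n ih => exact hm n (S n) ih
  set k : ℕ → ℕ := fun n => m n (S n) with hk
  have hSk (n : ℕ) (x : ℕ → ℕ) (hx : x ∈ S n) (i : ℕ) (hi : i < n) : x i ≤ k i := by
    induction n with
    | zero => omega
    | succ n ih =>
      rw [hSsucc] at hx
      rcases Nat.lt_succ_iff_lt_or_eq.1 hi with h' | rfl
      · exact ih hx.1 h'
      · exact hx.2
  set K : Set (ℕ → ℕ) := Set.pi univ fun i => Iic (k i) with hK
  have hKc : IsCompact K := isCompact_univ_pi fun i => (finite_Iic (k i)).isCompact
  have hopen (U : Set ℝ≥0) (hU : IsOpen U) (hKU : f '' K ⊆ U) : ∃ n, f '' S n ⊆ U := by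
    by_contra! hcon
    have hcon' (n : ℕ) : ∃ y ∈ S n, f y ∉ U := by
      simpa [image_subset_iff, not_subset] using hcon n
    choose y hyS hyU using hcon'
    -- Truncation by `k` moves `y n` into the compact `K` without changing its first `n`
    -- coordinates, so limit points of the truncations are limit points of `y`.
    have hz (n : ℕ) : (fun i => min (y n i) (k i)) ∈ K := fun i _ => min_le_right (y n i) (k i)
    obtain ⟨z, hzK, φ, hφ, hlim⟩ := hKc.tendsto_subseq hz
    have hylim : Tendsto (fun n => y (φ n)) atTop (𝓝 z) := by
      rw [tendsto_pi_nhds] at hlim ⊢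
      intro i
      refine (hlim i).congr' ?_
      filter_upwards [eventually_gt_atTop i] with n hn
      exact min_eq_left (hSk _ _ (hyS _) i (hn.trans_le (hφ.id_le n)))
    have hmem : f z ∈ U := hKU (mem_image_of_mem f hzK)
    obtain ⟨n, hn⟩ := (((hf.tendsto z).comp hylim).eventually (hU.mem_nhds hmem)).exists
    exact hyU _ hn
  refine ⟨f '' K, image_subset_range _ _, hKc.image hf, fun h0 => ?_⟩
  -- Fattening a cover to open sets by adding left neighbours at most doubles its weight, hence the
  -- half.
  have hc2 : 0 < c / 2 := by simp [hc0.ne']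
  obtain ⟨C, hC, hCl⟩ := exists_dyadicWeight_lt (h0.trans_lt hc2)
  choose U hUo hUs hUd using exists_isOpen_dyadic
  obtain ⟨n, hn⟩ := hopen (⋃ p ∈ C, U p) (isOpen_biUnion fun p _ => hUo p)
    (hC.trans (iUnion₂_mono fun p _ => hUs p))
  refine (hS n).not_ge ?_
  calc dyadicContent r (f '' S n)
      ≤ dyadicWeight r (C ∪ (fun p : ℕ × ℕ => (p.1, p.2 - 1)) '' C) := by
        refine dyadicContent_le (hn.trans (iUnion₂_subset fun p hp => (hUd p).trans ?_))
        refine union_subset (subset_biUnion_of_mem (u := dyadic) (Or.inl hp))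
          (subset_biUnion_of_mem (u := dyadic) (Or.inr (mem_image_of_mem _ hp)))
    _ ≤ dyadicWeight r C + dyadicWeight r C :=
        (measure_union_le _ _).trans (add_le_add le_rfl (dyadicWeight_leftNeighbour_le r C))
    _ ≤ c / 2 + c / 2 := add_le_add hCl.le hCl.le
    _ = c := ENNReal.add_halves c

/-! ### Frostman's lemma. -/

lemma dyadicContent_Ico_le (r : ℝ≥0∞) (n : ℕ) {a b : ℝ≥0} (hab : 2 ^ n * b ≤ 2 ^ n * a + 1) :
    dyadicContent r (Ico a b) ≤ 2 * r ^ n := by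
  have hsub : Ico a b ⊆ dyadic (n, ⌊2 ^ n * a⌋₊) ∪ dyadic (n, ⌊2 ^ n * a⌋₊ + 1) := by
    rintro t ⟨hat, htb⟩
    have h1 : (⌊2 ^ n * a⌋₊ : ℝ≥0) ≤ 2 ^ n * a := Nat.floor_le zero_le
    have h2 : 2 ^ n * a < (⌊2 ^ n * a⌋₊ : ℝ≥0) + 1 := Nat.lt_floor_add_one _
    have h3 : 2 ^ n * a ≤ 2 ^ n * t := by gcongr
    have h4 : 2 ^ n * t < 2 ^ n * b := by gcongr
    rcases lt_or_ge (2 ^ n * t) ((⌊2 ^ n * a⌋₊ : ℝ≥0) + 1) with h | h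
    · exact Or.inl (mem_dyadic_iff.2 ⟨h1.trans h3, h⟩)
    · refine Or.inr (mem_dyadic_iff.2 ⟨by push_cast; exact h, ?_⟩)
      push_cast
      exact (h4.trans_le hab).trans (by gcongr)
  calc dyadicContent r (Ico a b) ≤ _ := dyadicContent_mono r hsub
    _ ≤ _ := dyadicContent_union_le r _ _
    _ ≤ r ^ n + r ^ n := add_le_add (dyadicContent_dyadic_le r _) (dyadicContent_dyadic_le r _)
    _ = 2 * r ^ n := (two_mul _).symm

/-- **Frostman's lemma** on the half-line: a compact set of positive dyadic content carries a
nonzero measure whose mass on short intervals is controlled by the weights. -/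
lemma exists_frostman_of_isCompact {r : ℝ≥0∞} (hr : r < 1) {K : Set ℝ≥0} (hK : IsCompact K)
    (h : dyadicContent r K ≠ 0) :
    ∃ μ : Measure ℝ≥0, IsFiniteMeasure μ ∧ μ K ≠ 0 ∧ μ {0} = 0 ∧
      ∀ (n : ℕ) (a b : ℝ≥0), 2 ^ n * b ≤ 2 ^ n * a + 1 → μ (Ioc a b) ≤ 2 * r ^ n := by
  have hbdd : ∃ N : ℕ, ∀ t ∈ K, t < N := by
    obtain ⟨B, hB⟩ := hK.bddAbove
    obtain ⟨N, hN⟩ := exists_nat_gt B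
    exact ⟨N, fun t ht => (hB ht).trans_lt hN⟩
  obtain ⟨N, hN⟩ := hbdd
  have hKN : K ∩ Iio (N : ℝ≥0) = K := inter_eq_left.2 hN
  have hsub (a b : ℝ≥0) (hab : a ≤ b) : dyadicContent r (K ∩ Iio b) ≤
      dyadicContent r (K ∩ Iio a) + dyadicContent r (K ∩ Ico a b) := by
    rw [← Iio_union_Ico_eq_Iio hab, inter_union_distrib_left]
    exact dyadicContent_union_le _ _ _
  have hfin (b : ℝ≥0) : dyadicContent r (K ∩ Iio b) ≠ ∞ := by
    have hcov : K ⊆ ⋃ p ∈ (fun k : ℕ => ((0, k) : ℕ × ℕ)) '' (Finset.range N : Set ℕ),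
        dyadic p := by
      intro t ht
      refine mem_iUnion₂.2 ⟨(0, ⌊2 ^ 0 * t⌋₊), mem_image_of_mem _ ?_, mem_dyadic_floor 0 t⟩
      simpa using (Nat.floor_lt zero_le).2 (hN t ht)
    refine ne_top_of_le_ne_top ?_ ((dyadicContent_mono r inter_subset_left).trans
      (dyadicContent_le hcov))
    rw [dyadicWeight_apply]
    have : Finite ((fun k : ℕ => ((0, k) : ℕ × ℕ)) '' (Finset.range N : Set ℕ)) :=
      ((Finset.range N).finite_toSet.image _).to_subtype
    have := Fintype.ofFinite ((fun k : ℕ => ((0, k) : ℕ × ℕ)) '' (Finset.range N : Set ℕ))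
    rw [tsum_fintype]
    exact (ENNReal.sum_lt_top.2 fun p _ => (pow_le_one' hr.le _).trans_lt ENNReal.one_lt_top).ne
  -- Subadditivity bounds the increments of `F` by the content of the part of `K` in between. With
  -- `Iio` the increments live on `Ico` intervals, and their smallness, due to `r < 1`, gives
  -- right-continuity.
  set F : ℝ≥0 → ℝ := fun t => (dyadicContent r (K ∩ Iio t)).toReal with hF
  have hmono : Monotone F := fun a b hab =>
    ENNReal.toReal_mono (hfin b) (dyadicContent_mono r (inter_subset_inter_right _ (Iio_subset_Iio hab)))
  have hinc (a b : ℝ≥0) (hab : a ≤ b) :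
      ENNReal.ofReal (F b - F a) ≤ dyadicContent r (K ∩ Ico a b) := by
    rw [ENNReal.ofReal_sub _ ENNReal.toReal_nonneg, ENNReal.ofReal_toReal (hfin b),
      ENNReal.ofReal_toReal (hfin a), tsub_le_iff_left]
    exact hsub a b hab
  have hinc2 (n : ℕ) (a b : ℝ≥0) (hab : a ≤ b) (hn : 2 ^ n * b ≤ 2 ^ n * a + 1) :
      ENNReal.ofReal (F b - F a) ≤ 2 * r ^ n :=
    (hinc a b hab).trans ((dyadicContent_mono r inter_subset_right).trans
      (dyadicContent_Ico_le r n hn))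
  have hpow : Tendsto (fun n : ℕ => 2 * r ^ n) atTop (𝓝 0) := by
    simpa using ENNReal.Tendsto.const_mul (ENNReal.tendsto_pow_atTop_nhds_zero_of_lt_one hr)
      (Or.inr ENNReal.ofNat_ne_top)
  have hright (x : ℝ≥0) : ContinuousWithinAt F (Ici x) x := by
    refine tendsto_order.2 ⟨fun y hy => ?_, fun y hy => ?_⟩
    · filter_upwards [self_mem_nhdsWithin] with t ht using hy.trans_le (hmono ht)
    · obtain ⟨n, hn⟩ := (hpow.eventually (gt_mem_nhds (ENNReal.ofReal_pos.2 (sub_pos.2 hy)))).exists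
      have hnhds : {t : ℝ≥0 | 2 ^ n * t < 2 ^ n * x + 1} ∈ 𝓝 x :=
        (isOpen_lt (by fun_prop) (by fun_prop)).mem_nhds
          (lt_add_one (2 ^ n * x))
      filter_upwards [self_mem_nhdsWithin, mem_nhdsWithin_of_mem_nhds hnhds] with t ht ht2
      have := (hinc2 n x t ht (le_of_lt ht2)).trans_lt hn
      rw [ENNReal.ofReal_lt_ofReal_iff (sub_pos.2 hy)] at this
      linarith
  let G : StieltjesFunction ℝ≥0 := ⟨F, hmono, hright⟩
  have hG (a b : ℝ≥0) : G.measure (Ioc a b) = ENNReal.ofReal (F b - F a) := G.measure_Ioc a b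
  have hF0 : F 0 = 0 := by
    simp [hF, dyadicContent_empty]
  have hFN : F N = (dyadicContent r K).toReal := by
    simp only [hF, hKN]
  have hF_le (t : ℝ≥0) : |F t| ≤ F N := by
    rw [abs_of_nonneg ENNReal.toReal_nonneg, hFN]
    refine ENNReal.toReal_mono ?_ (dyadicContent_mono r inter_subset_left)
    rw [← hKN]
    exact hfin N
  have hfinm : IsFiniteMeasure G.measure := G.isFiniteMeasure_of_forall_abs_le hF_le
  have hzero : G.measure {0} = 0 := by
    have := G.measure_botSet
    rwa [botSet_eq_singleton_of_isBot (x := 0) fun _ => zero_le] at this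
  -- `F` is constant near a point off `K`. The origin has no room on its left and is treated by
  -- `hzero`.
  have hnull' : G.measure (Kᶜ \ {0}) = 0 := by
    refine measure_null_of_locally_null _ fun t ht => ?_
    have ht0 : 0 < t := pos_iff_ne_zero.2 ht.2
    obtain ⟨l, u, ⟨hlt, htu⟩, hlu⟩ := (mem_nhds_iff_exists_Ioo_subset' ⟨0, ht0⟩ (exists_gt t)).1
      (hK.isClosed.isOpen_compl.mem_nhds ht.1)
    obtain ⟨l', hl, hl'⟩ := exists_between hlt
    refine ⟨Ioo l' u, mem_nhdsWithin_of_mem_nhds (Ioo_mem_nhds hl' htu),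
      measure_mono_null Ioo_subset_Ioc_self ?_⟩
    have hempty : K ∩ Ico l' u = ∅ :=
      disjoint_iff_inter_eq_empty.1 (disjoint_left.2 fun s hs hs' =>
        hlu ⟨hl.trans_le hs'.1, hs'.2⟩ hs)
    have := hinc l' u (hl'.trans htu).le
    rw [hempty, dyadicContent_empty] at this
    rw [hG]
    exact le_antisymm this zero_le
  have hnull : G.measure Kᶜ = 0 :=
    measure_mono_null (subset_sdiff_union Kᶜ {0}) (measure_union_null hnull' hzero)
  refine ⟨G.measure, hfinm, fun h0 => ?_, hzero, fun n a b hab => ?_⟩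
  · have huniv : G.measure (Ioc 0 (N : ℝ≥0)) = 0 :=
      measure_mono_null (subset_univ _) (by
        rw [← union_compl_self K]; exact measure_union_null h0 hnull)
    rw [hG, hF0, sub_zero, ENNReal.ofReal_eq_zero, hFN] at huniv
    have hKfin : dyadicContent r K ≠ ∞ := by
      rw [← hKN]
      exact hfin N
    exact huniv.not_gt (ENNReal.toReal_pos h hKfin)
  · rw [hG]
    rcases le_total a b with h | h
    · exact hinc2 n a b h hab
    · rw [ENNReal.ofReal_of_nonpos (sub_nonpos.2 (hmono h))]
      exact zero_le

/-- **Frostman's lemma** for analytic sets of nonnegative reals. -/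
lemma exists_frostman {a : ℝ≥0} (ha : 0 < a) {E : Set ℝ≥0} (hE : AnalyticSet E)
    (h : (a : ℝ≥0∞) < dimH E) :
    ∃ μ : Measure ℝ≥0, IsFiniteMeasure μ ∧ μ E ≠ 0 ∧ ∀ (n : ℕ) (t : ℝ≥0),
      μ (Metric.closedEBall t ((2 : ℝ≥0∞)⁻¹ ^ n)) ≤ 6 * ((2 : ℝ≥0∞) ^ (-(a : ℝ))) ^ n := by
  set r : ℝ≥0∞ := (2 : ℝ≥0∞) ^ (-(a : ℝ)) with hr
  have hr1 : r < 1 := by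
    rw [hr, ENNReal.rpow_neg, ENNReal.inv_lt_one]
    exact ENNReal.one_lt_rpow (by norm_num) (by exact_mod_cast ha)
  have hcont : dyadicContent r E ≠ 0 := fun h0 => by
    have h1 := hausdorffMeasure_eq_zero_of_dyadicContent (by exact_mod_cast ha) h0
    rw [hausdorffMeasure_of_lt_dimH h] at h1
    exact ENNReal.top_ne_zero h1
  obtain ⟨K, hKE, hK, hK0⟩ := exists_isCompact_dyadicContent_pos hE hcont
  obtain ⟨μ, hμ, hμK, hμ0, hμI⟩ := exists_frostman_of_isCompact hr1 hK hK0
  refine ⟨μ, hμ, fun h0 => hμK (measure_mono_null hKE h0), fun n t => ?_⟩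
  set d : ℝ≥0 := (2 : ℝ≥0)⁻¹ ^ n with hd
  have hd2 : 2 ^ n * d = 1 := by rw [hd, ← mul_pow]; simp
  have hdcoe : (d : ℝ≥0∞) = (2 : ℝ≥0∞)⁻¹ ^ n := by
    rw [hd, ENNReal.coe_pow, ENNReal.coe_inv two_ne_zero, ENNReal.coe_ofNat]
  have hshort (x y : ℝ≥0) (hxy : y ≤ x + d) : μ (Ioc x y) ≤ 2 * r ^ n := by
    refine hμI n x y ?_
    calc 2 ^ n * y ≤ 2 ^ n * (x + d) := by gcongr
      _ = 2 ^ n * x + 1 := by rw [mul_add, hd2]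
  -- The third interval catches the left endpoint `t - d`, and `{0}` the case of truncated
  -- subtraction; three intervals of mass `2 * r ^ n` give the constant 6.
  have hsub : Metric.closedEBall t ((2 : ℝ≥0∞)⁻¹ ^ n) ⊆
      {0} ∪ (Ioc (t - d - d) (t - d) ∪ (Ioc (t - d) t ∪ Ioc t (t + d))) := by
    intro u hu
    rw [Metric.mem_closedEBall, ← hdcoe, edist_nndist, ENNReal.coe_le_coe,
      ← NNReal.coe_le_coe, coe_nndist, NNReal.dist_eq, abs_le] at hu
    have h1 : u ≤ t + d := by
      rw [← NNReal.coe_le_coe]; push_cast; linarith [hu.2]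
    have h2 : t - d ≤ u := by
      rw [tsub_le_iff_right, ← NNReal.coe_le_coe]; push_cast; linarith [hu.1]
    rcases eq_or_ne u 0 with h0 | h0
    · exact Or.inl h0
    rcases lt_or_ge t u with h3 | h3
    · exact Or.inr (Or.inr (Or.inr ⟨h3, h1⟩))
    rcases h2.lt_or_eq with h4 | h4
    · exact Or.inr (Or.inr (Or.inl ⟨h4, h3⟩))
    · refine Or.inr (Or.inl ⟨?_, h4.ge⟩)
      rw [h4]
      refine tsub_lt_self (pos_iff_ne_zero.2 h0) ?_
      rw [hd]
      positivity
  calc μ (Metric.closedEBall t ((2 : ℝ≥0∞)⁻¹ ^ n))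
      ≤ μ {0} + (μ (Ioc (t - d - d) (t - d)) + (μ (Ioc (t - d) t) + μ (Ioc t (t + d)))) :=
        (measure_mono hsub).trans <| (measure_union_le _ _).trans <| add_le_add le_rfl <|
          (measure_union_le _ _).trans <| add_le_add le_rfl <| measure_union_le _ _
    _ ≤ 0 + (2 * r ^ n + (2 * r ^ n + 2 * r ^ n)) := by
        rw [hμ0]
        gcongr
        · exact hshort _ _ le_tsub_add
        · exact hshort _ _ le_tsub_add
        · exact hshort _ _ le_rfl
    _ = 6 * r ^ n := by ring

/-! ### Potentials and energy. -/

/-- A measure with the Frostman property of exponent `a` has bounded `b`-potential for `b < a`. -/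
lemma exists_lintegral_edist_rpow_le {a b : ℝ} (hb : 0 < b) (hba : b < a) {C : ℝ≥0∞} (hC : C ≠ ∞)
    {μ : Measure ℝ≥0} [IsFiniteMeasure μ] (hμ : ∀ (n : ℕ) (t : ℝ≥0),
      μ (Metric.closedEBall t ((2 : ℝ≥0∞)⁻¹ ^ n)) ≤ C * ((2 : ℝ≥0∞) ^ (-a)) ^ n) :
    ∃ D : ℝ≥0∞, D ≠ ∞ ∧ ∀ t, μ {t} = 0 ∧ ∫⁻ u, edist t u ^ (-b) ∂μ ≤ D := by
  set r : ℝ≥0∞ := (2 : ℝ≥0∞) ^ (-a) with hr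
  set z : ℝ≥0∞ := (2 : ℝ≥0∞) ^ b with hz
  have hr1 : r < 1 := by
    rw [hr, ENNReal.rpow_neg, ENNReal.inv_lt_one]
    exact ENNReal.one_lt_rpow (by norm_num) (hb.trans hba)
  have hzr : z * r < 1 := by
    rw [hz, hr, ← ENNReal.rpow_add _ _ (by norm_num) (by norm_num)]
    exact ENNReal.rpow_lt_one_of_one_lt_of_neg (by norm_num) (by linarith)
  have hztop : z ≠ ∞ := ENNReal.rpow_ne_top_of_nonneg hb.le (by norm_num)
  have hatom (t : ℝ≥0) : μ {t} = 0 := by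
    have hlim : Filter.Tendsto (fun n : ℕ => C * r ^ n) Filter.atTop (nhds 0) := by
      simpa using ENNReal.Tendsto.const_mul (ENNReal.tendsto_pow_atTop_nhds_zero_of_lt_one hr1)
        (Or.inr hC)
    refine le_antisymm (ge_of_tendsto' hlim fun n => (measure_mono ?_).trans (hμ n t)) zero_le
    exact singleton_subset_iff.2 (Metric.mem_closedEBall_self)
  -- On the shell `2⁻¹ ^ (n + 1) < |t - u| ≤ 2⁻¹ ^ n` the kernel is at most `z ^ (n + 1)`.
  -- Integration gives a geometric series of ratio `z * r = 2 ^ (b - a) < 1`.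
  have hpt (t u : ℝ≥0) (htu : u ≠ t) : edist t u ^ (-b) ≤ 1 + ∑' n : ℕ,
      (Metric.closedEBall t ((2 : ℝ≥0∞)⁻¹ ^ n)).indicator (fun _ => z ^ (n + 1)) u := by
    rcases le_or_gt 1 (edist t u) with h1 | h1
    · refine le_add_right ?_
      rw [ENNReal.rpow_neg, ENNReal.inv_le_one]
      exact ENNReal.one_le_rpow h1 hb
    · have hpos : 0 < nndist t u := by
        rw [pos_iff_ne_zero, Ne, nndist_eq_zero]
        exact htu.symm
      rw [edist_nndist] at h1 ⊢
      obtain ⟨n, hn1, hn2⟩ := exists_nat_pow_near_of_lt_one hpos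
        (by exact_mod_cast h1.le : nndist t u ≤ 1) (by simp : (0 : ℝ≥0) < 2⁻¹)
        (by rw [← NNReal.coe_lt_coe]; push_cast; norm_num : (2⁻¹ : ℝ≥0) < 1)
      have hcoe (k : ℕ) : (((2 : ℝ≥0)⁻¹ ^ k : ℝ≥0) : ℝ≥0∞) = (2 : ℝ≥0∞)⁻¹ ^ k := by
        rw [ENNReal.coe_pow, ENNReal.coe_inv two_ne_zero, ENNReal.coe_ofNat]
      refine le_trans ?_ (le_add_left (ENNReal.le_tsum n))
      rw [indicator_of_mem]
      · calc (nndist t u : ℝ≥0∞) ^ (-b) ≤ ((2 : ℝ≥0∞)⁻¹ ^ (n + 1)) ^ (-b) := by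
              rw [ENNReal.rpow_neg, ENNReal.rpow_neg, ENNReal.inv_le_inv, ← hcoe]
              exact ENNReal.rpow_le_rpow (ENNReal.coe_le_coe.2 hn1.le) hb.le
          _ = z ^ (n + 1) := by
              rw [hz, ← ENNReal.rpow_natCast, ← ENNReal.rpow_natCast, ← ENNReal.rpow_mul,
                ← ENNReal.rpow_mul, ← ENNReal.rpow_neg_one, ← ENNReal.rpow_mul]
              ring_nf
      · rw [Metric.mem_closedEBall, edist_comm, edist_nndist, ← hcoe]
        exact ENNReal.coe_le_coe.2 hn2
  refine ⟨μ univ + C * z * ∑' n : ℕ, (z * r) ^ n, ?_, fun t => ⟨hatom t, ?_⟩⟩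
  · refine ENNReal.add_ne_top.2 ⟨measure_ne_top _ _, ENNReal.mul_ne_top
      (ENNReal.mul_ne_top hC hztop) ?_⟩
    rw [ENNReal.tsum_geometric]
    exact ENNReal.inv_ne_top.2 (tsub_pos_of_lt hzr).ne'
  · calc ∫⁻ u, edist t u ^ (-b) ∂μ
        ≤ ∫⁻ u, (1 + ∑' n : ℕ, (Metric.closedEBall t ((2 : ℝ≥0∞)⁻¹ ^ n)).indicator
            (fun _ => z ^ (n + 1)) u) ∂μ := by
          refine lintegral_mono_ae ?_
          have : ∀ᵐ u ∂μ, u ≠ t := by simp [ae_iff, hatom t]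
          filter_upwards [this] with u hu using hpt t u hu
      _ = μ univ + ∑' n : ℕ, z ^ (n + 1) * μ (Metric.closedEBall t ((2 : ℝ≥0∞)⁻¹ ^ n)) := by
          rw [lintegral_add_left measurable_const, lintegral_one, lintegral_tsum
            fun n => (measurable_const.indicator Metric.isClosed_closedEBall.measurableSet).aemeasurable]
          congr 2
          ext n
          rw [lintegral_indicator_const Metric.isClosed_closedEBall.measurableSet]
      _ ≤ μ univ + ∑' n : ℕ, C * z * (z * r) ^ n := by
          refine add_le_add le_rfl (ENNReal.tsum_le_tsum fun n => ?_)
          calc _ ≤ z ^ (n + 1) * (C * r ^ n) := by gcongr; exact hμ n t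
            _ = _ := by rw [mul_pow]; ring
      _ = _ := by rw [ENNReal.tsum_mul_left]

/-- The energy method: if a measure charging `E` has finite `s`-energy along `y`, then the image of
`E` under `y` has Hausdorff dimension at least `s`. -/
lemma le_dimH_image_of_lintegral_edist {T X : Type*} [MeasurableSpace T] [MetricSpace X]
    [MeasurableSpace X] [BorelSpace X] [SecondCountableTopology X] {y : T → X} (hy : Measurable y)
    {ν : Measure T} [SFinite ν] {E : Set T} (hE : ν E ≠ 0) {s : ℝ≥0}
    (h : ∫⁻ t, ∫⁻ u, edist (y t) (y u) ^ (-(s : ℝ)) ∂ν ∂ν ≠ ∞) : (s : ℝ≥0∞) ≤ dimH (y '' E) := by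
  set φ : T → ℝ≥0∞ := fun t => ∫⁻ u, edist (y t) (y u) ^ (-(s : ℝ)) ∂ν with hφ
  have hmeas : Measurable (fun p : T × T => edist (y p.1) (y p.2) ^ (-(s : ℝ))) :=
    ((hy.comp measurable_fst).edist (hy.comp measurable_snd)).pow_const _
  have hφm : Measurable φ := hmeas.lintegral_prod_right'
  have hfin : ∀ᵐ t ∂ν, φ t < ∞ := ae_lt_top hφm h
  obtain ⟨N, hN⟩ : ∃ N : ℕ, ν (E ∩ {t | φ t ≤ N}) ≠ 0 := by
    by_contra! hcon
    refine hE (measure_mono_null ?_ (measure_union_null (measure_iUnion_null hcon)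
      (ae_iff.1 hfin)))
    intro t ht
    by_cases hft : φ t < ∞
    · obtain ⟨N, hN⟩ := ENNReal.exists_nat_gt hft.ne
      exact Or.inl (mem_iUnion.2 ⟨N, ht, hN.le⟩)
    · exact Or.inr hft
  set B : Set T := {t | φ t ≤ N} with hB
  have hBm : MeasurableSet B := measurableSet_le hφm measurable_const
  set c : ℝ≥0∞ := ((N : ℝ≥0∞) + 1)⁻¹ with hc
  have hNtop : (N : ℝ≥0∞) + 1 ≠ ∞ := by simp
  have hN0 : (N : ℝ≥0∞) + 1 ≠ 0 := by simp
  -- Mass distribution principle: if `S` meets the image of `B` at `y t`, the kernel based at `y t`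
  -- is at least `diam S ^ (-s)` on `S`, while its integral `φ t` is at most `N`. The `+ 1` in `c`
  -- avoids inverting zero.
  have hle : c • Measure.map y (ν.restrict B) ≤ Measure.hausdorffMeasure (s : ℝ) := by
    refine Measure.le_hausdorffMeasure _ _ 1 one_pos fun S _ => ?_
    rw [← Metric.ediam_closure S, Measure.smul_apply, smul_eq_mul]
    refine (mul_le_mul_right (measure_mono subset_closure) c).trans ?_
    have hSm : MeasurableSet (closure S) := isClosed_closure.measurableSet
    rw [Measure.map_apply hy hSm, Measure.restrict_apply (hy hSm)]
    rcases (y ⁻¹' closure S ∩ B).eq_empty_or_nonempty with hem | ⟨t, htS, htB⟩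
    · simp [hem]
    have hδ : (Metric.ediam (closure S)) ^ (-(s : ℝ)) * ν (y ⁻¹' closure S ∩ B) ≤ N + 1 := by
      calc (Metric.ediam (closure S)) ^ (-(s : ℝ)) * ν (y ⁻¹' closure S ∩ B)
          = ∫⁻ _ in y ⁻¹' closure S ∩ B, (Metric.ediam (closure S)) ^ (-(s : ℝ)) ∂ν := by
            rw [setLIntegral_const]
        _ ≤ ∫⁻ u in y ⁻¹' closure S ∩ B, edist (y t) (y u) ^ (-(s : ℝ)) ∂ν := by
            refine setLIntegral_mono' ((hy hSm).inter hBm) fun u hu => ?_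
            rw [ENNReal.rpow_neg, ENNReal.rpow_neg, ENNReal.inv_le_inv]
            exact ENNReal.rpow_le_rpow (Metric.edist_le_ediam_of_mem htS hu.1) s.2
        _ ≤ φ t := setLIntegral_le_lintegral _ _
        _ ≤ N + 1 := (show φ t ≤ N from htB).trans le_self_add
    rw [ENNReal.rpow_neg] at hδ
    rw [hc, ENNReal.inv_mul_le_iff hN0 hNtop]
    rw [mul_comm (N + 1 : ℝ≥0∞)]
    by_cases h0 : Metric.ediam (closure S) ^ (s : ℝ) = 0
    · rw [h0, ENNReal.inv_zero] at hδ
      rcases eq_or_ne (ν (y ⁻¹' closure S ∩ B)) 0 with h1 | h1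
      · simp [h1]
      · rw [ENNReal.top_mul h1] at hδ
        exact (hNtop (top_le_iff.1 hδ)).elim
    · by_cases h2 : Metric.ediam (closure S) ^ (s : ℝ) = ∞
      · rw [h2, ENNReal.top_mul hN0]
        exact le_top
      · exact (ENNReal.inv_mul_le_iff h0 h2).1 hδ
  refine le_dimH_of_hausdorffMeasure_ne_zero fun h0 => hN ?_
  have h1 : c * Measure.map y (ν.restrict B) (y '' E) = 0 :=
    le_antisymm ((Measure.le_iff'.1 hle (y '' E)).trans_eq h0) zero_le
  have h2 : Measure.map y (ν.restrict B) (y '' E) = 0 :=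
    (mul_eq_zero.1 h1).resolve_left (ENNReal.inv_ne_zero.2 hNtop)
  -- `y '' E` need not be measurable; `le_map_apply` is the inequality that survives.
  have h3 : ν.restrict B E = 0 := measure_mono_null (subset_preimage_image y E)
    (le_antisymm ((Measure.le_map_apply hy.aemeasurable _).trans_eq h2) zero_le)
  rwa [Measure.restrict_apply' hBm] at h3

/-! ### Application to the process. -/

/-- Jensen's inequality, as monotonicity of `L^p` norms on a probability space between the exponents
`b` and 1. -/
lemma lintegral_rpow_mul_le {Ω : Type*} [MeasurableSpace Ω] {P : Measure Ω} [IsProbabilityMeasure P]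
    {f : Ω → ℝ≥0∞} (hf : Measurable f) {l b : ℝ} (hb : 0 < b) (hb1 : b ≤ 1) :
    ∫⁻ ω, f ω ^ (l * b) ∂P ≤ (∫⁻ ω, f ω ^ l ∂P) ^ b := by
  have h := eLpNorm'_le_eLpNorm'_of_exponent_le hb hb1 P
    (hf.pow_const l).aestronglyMeasurable
  simp only [eLpNorm'_eq_lintegral_enorm, enorm_eq_self, ENNReal.rpow_one, div_one] at h
  rw [one_div, ENNReal.rpow_inv_le_iff hb] at h
  simpa only [ENNReal.rpow_mul] using h

lemma dimH_nnreal_le_one (E : Set ℝ≥0) : dimH E ≤ 1 := by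
  have h : Isometry ((↑) : ℝ≥0 → ℝ) := fun _ _ => rfl
  rw [← h.dimH_image E, ← Real.dimH_univ]
  exact dimH_mono (subset_univ _)

namespace MarkovProcess

variable {d : ℕ} {Ω : Type*} [MeasurableSpace Ω]

lemma ae_mul_le_dimH_image (M : MarkovProcess d Ω)
    (hM : Measurable fun p : ℝ≥0 × Ω => M.Y p.1 p.2) (x : EuclideanSpace ℝ (Fin d))
    {E : Set ℝ≥0} (hE : AnalyticSet E) {l : ℝ≥0} (hl : M.NegMomentBound x l) {b : ℝ≥0}
    (hb : (b : ℝ≥0∞) < dimH E) :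
    ∀ᵐ ω ∂(M.P x), (l : ℝ≥0∞) * b ≤ dimH ((fun t => M.Y t ω) '' E) := by
  rcases eq_zero_or_pos l with rfl | hl0
  · simp
  rcases eq_zero_or_pos b with rfl | hb0
  · simp
  have hb1 : (b : ℝ) ≤ 1 := by exact_mod_cast (hb.le.trans (dimH_nnreal_le_one E))
  obtain ⟨a, hba, haE⟩ := ENNReal.lt_iff_exists_nnreal_btwn.1 hb
  have hba' : (b : ℝ) < a := by exact_mod_cast hba
  obtain ⟨μ, hμ, hμE, hμball⟩ := exists_frostman (hb0.trans (by exact_mod_cast hba')) hE haE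
  obtain ⟨D, hD, hpot⟩ := exists_lintegral_edist_rpow_le (by exact_mod_cast hb0) hba'
    (by norm_num) hμball
  obtain ⟨C, δ, hδ, hbound⟩ := hl
  -- The moment bound holds only for times closer than `δ`, so `μ` is restricted to a ball of radius
  -- `δ / 2` around a point all of whose neighbourhoods meet `E` in positive mass.
  obtain ⟨t₀, -, ht₀⟩ := exists_mem_forall_mem_nhdsWithin_pos_measure hμE
  set J : Set ℝ≥0 := Metric.ball t₀ (δ / 2) with hJ
  set ν : Measure ℝ≥0 := μ.restrict J with hν
  have hνE : ν E ≠ 0 := by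
    rw [hν, Measure.restrict_apply' Metric.isOpen_ball.measurableSet]
    exact (ht₀ _ (inter_mem_nhdsWithin E (Metric.ball_mem_nhds t₀ (half_pos hδ)))).ne'
  have := M.isProbabilityMeasure x
  have hmeas : Measurable fun p : Ω × ℝ≥0 × ℝ≥0 =>
      edist (M.Y p.2.1 p.1) (M.Y p.2.2 p.1) ^ (-((l * b : ℝ≥0) : ℝ)) := by
    refine Measurable.pow_const (Measurable.edist ?_ ?_) _
    · exact hM.comp (measurable_snd.fst.prodMk measurable_fst)
    · exact hM.comp (measurable_snd.snd.prodMk measurable_fst)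
  have hYm (t : ℝ≥0) : Measurable (M.Y t) := hM.comp (measurable_const.prodMk measurable_id)
  have hmoment (t u : ℝ≥0) (ht : t ∈ J) (hu : u ∈ J) (htu : u ≠ t) :
      ∫⁻ ω, edist (M.Y t ω) (M.Y u ω) ^ (-((l * b : ℝ≥0) : ℝ)) ∂(M.P x)
        ≤ (C : ℝ≥0∞) ^ (b : ℝ) * edist t u ^ (-(b : ℝ)) := by
    have hd : dist t u < δ := by
      have := dist_triangle_right t u t₀
      rw [hJ, Metric.mem_ball] at ht hu
      linarith
    have h1 := lintegral_rpow_mul_le (P := M.P x) (f := fun ω => edist (M.Y t ω) (M.Y u ω))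
      ((hYm t).edist (hYm u)) (l := -(l : ℝ)) (b := b) (by exact_mod_cast hb0) hb1
    have h2 := hbound u t htu hd
    simp only [← edist_eq_enorm_sub] at h2
    calc _ = ∫⁻ ω, edist (M.Y t ω) (M.Y u ω) ^ (-(l : ℝ) * b) ∂(M.P x) := by
          push_cast; simp only [neg_mul]
      _ ≤ _ := h1
      _ ≤ (C * (edist t u)⁻¹) ^ (b : ℝ) := ENNReal.rpow_le_rpow h2 b.2
      _ = _ := by rw [ENNReal.mul_rpow_of_nonneg _ _ b.coe_nonneg, ENNReal.inv_rpow, ENNReal.rpow_neg]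
  have hinner (t : ℝ≥0) (ht : t ∈ J) :
      ∫⁻ u, ∫⁻ ω, edist (M.Y t ω) (M.Y u ω) ^ (-((l * b : ℝ≥0) : ℝ)) ∂(M.P x) ∂ν
        ≤ (C : ℝ≥0∞) ^ (b : ℝ) * D := by
    -- The moment bound says nothing on the diagonal, which is negligible because `μ` has no atoms.
    have hne : ∀ᵐ u ∂ν, u ≠ t := ae_restrict_of_ae (by simp [ae_iff, (hpot t).1])
    calc _ ≤ ∫⁻ u, (C : ℝ≥0∞) ^ (b : ℝ) * edist t u ^ (-(b : ℝ)) ∂ν := by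
          refine lintegral_mono_ae ?_
          filter_upwards [hne, ae_restrict_mem Metric.isOpen_ball.measurableSet] with u hu huJ
          exact hmoment t u ht huJ hu
      _ = (C : ℝ≥0∞) ^ (b : ℝ) * ∫⁻ u, edist t u ^ (-(b : ℝ)) ∂ν :=
          lintegral_const_mul _ ((measurable_const.edist measurable_id).pow_const _)
      _ ≤ _ := by
          gcongr
          exact (setLIntegral_le_lintegral _ _).trans (hpot t).2
  have henergy : ∫⁻ ω, ∫⁻ p : ℝ≥0 × ℝ≥0,
      edist (M.Y p.1 ω) (M.Y p.2 ω) ^ (-((l * b : ℝ≥0) : ℝ)) ∂(ν.prod ν) ∂(M.P x) ≠ ∞ := by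
    rw [lintegral_lintegral_swap (f := fun ω (p : ℝ≥0 × ℝ≥0) =>
      edist (M.Y p.1 ω) (M.Y p.2 ω) ^ (-((l * b : ℝ≥0) : ℝ))) hmeas.aemeasurable,
      lintegral_prod _ hmeas.lintegral_prod_left'.aemeasurable]
    refine ne_top_of_le_ne_top (b := ∫⁻ _, (C : ℝ≥0∞) ^ (b : ℝ) * D ∂ν) ?_ ?_
    · rw [lintegral_const]
      exact ENNReal.mul_ne_top (ENNReal.mul_ne_top
        (ENNReal.rpow_ne_top_of_nonneg b.2 ENNReal.coe_ne_top) hD) (measure_ne_top _ _)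
    · refine lintegral_mono_ae ?_
      filter_upwards [ae_restrict_mem Metric.isOpen_ball.measurableSet] with t ht using hinner t ht
  filter_upwards [ae_lt_top hmeas.lintegral_prod_right' henergy] with ω hω
  have hsec : Measurable fun t => M.Y t ω := hM.comp (measurable_id.prodMk measurable_const)
  rw [← ENNReal.coe_mul]
  refine le_dimH_image_of_lintegral_edist hsec hνE ?_
  have hprod := lintegral_prod (μ := ν) (ν := ν)
    (fun p : ℝ≥0 × ℝ≥0 => edist (M.Y p.1 ω) (M.Y p.2 ω) ^ (-((l * b : ℝ≥0) : ℝ)))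
    (hmeas.comp (measurable_const.prodMk measurable_id)).aemeasurable
  exact hprod ▸ hω.ne

end MarkovProcess

theorem lemma2p3 {d : ℕ} {Ω : Type*} [MeasurableSpace Ω] (M : MarkovProcess d Ω)
    (hM : Measurable fun p : ℝ≥0 × Ω => M.Y p.1 p.2)
    (x : EuclideanSpace ℝ (Fin d)) (E : Set ℝ≥0) (hE : AnalyticSet E) (hE1 : E ⊆ Icc 0 1) :
    ∀ᵐ ω ∂(M.P x), M.betaPrime x * dimH E ≤ dimH ((fun t => M.Y t ω) '' E) := by
  set S : Set ℝ≥0∞ := {b : ℝ≥0∞ | ∃ l : ℝ≥0, M.NegMomentBound x l ∧ b = l} with hS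
  have hβ : M.betaPrime x = sSup S := rfl
  rcases S.eq_empty_or_nonempty with hem | hne
  · simp [hβ, hem]
  obtain ⟨v, -, hv, hvS⟩ := exists_seq_tendsto_sSup hne (OrderTop.bddAbove S)
  choose l hl hvl using hvS
  -- A sequence of `l` tending to the supremum and rational `q` keep the exceptional null sets
  -- countable in number.
  have hall : ∀ᵐ ω ∂(M.P x), ∀ (n : ℕ) (q : ℚ), ((q : ℝ).toNNReal : ℝ≥0∞) < dimH E →
      (l n : ℝ≥0∞) * (q : ℝ).toNNReal ≤ dimH ((fun t => M.Y t ω) '' E) := by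
    refine ae_all_iff.2 fun n => ae_all_iff.2 fun q => ?_
    by_cases hq : ((q : ℝ).toNNReal : ℝ≥0∞) < dimH E
    · filter_upwards [M.ae_mul_le_dimH_image hM x hE (hl n) hq] with ω hω _ using hω
    · exact Filter.Eventually.of_forall fun ω h => (hq h).elim
  filter_upwards [hall] with ω hω
  refine ENNReal.mul_le_of_forall_lt fun β' hβ' b hb => ?_
  obtain ⟨n, hn⟩ := (hv.eventually (lt_mem_nhds (hβ ▸ hβ'))).exists
  obtain ⟨q, -, hbq, hq⟩ := ENNReal.lt_iff_exists_rat_btwn.1 hb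
  exact (mul_le_mul' (hvl n ▸ hn.le) hbq.le).trans (hω n q hq)
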